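/- Let $\mathbb{F}=\mathbb{R}$ or $\mathbb{C}$ and let $H,H'$ be Hilbert spaces over $\mathbb{F}$. For a $*$-algebra $B$ let $\mathcal{P}(B)$ be the set of its projections (self-adjoint idempotents), ordered by $p\le q\Leftrightarrow pq=p$; write $\mathcal{R}(T)$ for the range of an operator $T$, $\bigvee p_n$ for the least upper bound of a sequence $(p_n)$ in $\mathcal{P}(\mathcal{B}(H'))$ (i.e. the orthogonal projection onto the closed linear span of the ranges $\mathcal{R}(p_n)$), and $\sum$ of subspaces for their (not necessarily closed) linear span. A unital C$^*$-algebra has *real rank zero* if its invertible self-adjoint elements are dense in its self-adjoint elements. A unital C$^*$-algebra $B$ has the *$\omega$-property* if $\|(1-p)p_n\|\to0$ whenever $p\in\mathcal{P}(B)$ and $(p_n)\subseteq\mathcal{P}(B)$ is a decreasing sequence such that every $r\in\mathcal{P}(B)$ with $r\le p_n$ for all $n$ satisfies $r\le p$. **Theorem.** Let $A\subseteq\mathcal{B}(H)$ be a norm-closed $*$-subalgebra that contains the identity operator and has real rank zero, and let $\pi:A\to\mathcal{B}(H')$ be a unital $*$-homomorphism (linear over $\mathbb{F}$) such that $\pi[A]$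 has the $\omega$-property. Then, for every sequence $(P_n)_{n\ge0}\subseteq\mathcal{P}(A)$: 1. there is a (possibly non-strictly) increasing sequence $(Q_n)_{n\ge0}\subseteq\mathcal{P}(A)$ such that $\mathcal{R}(Q_n)\subseteq\sum_{k\le n}\mathcal{R}(P_k)$ for all $n$, and $\bigvee\pi(P_n)=\bigvee\pi(Q_n)$; 2. if $p$ is a least upper bound of $(\pi(P_n))$ in $\mathcal{P}(\pi[A])$, then there is $P\in\mathcal{P}(A)$ with $p=\pi(P)$ and $\mathcal{R}(P)\subseteq\sum_{n}\mathcal{R}(P_n)$. -/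

import Mathlib

open Filter Topology Set

/-- The set `𝒫(R)` of projections (self-adjoint idempotents) of a `*`-algebra `R`. -/
structure Proj (R : Type*) [Mul R] [Star R] where
  val : R
  isProj : IsStarProjection val

namespace Proj

theorem ext_val {R : Type*} [Mul R] [Star R] {p q : Proj R} (h : p.val = q.val) : p = q := by
  cases p; cases q; cases h; rfl

/-- The canonical order on projections: `p ≤ q` if and only if `p q = p`. -/
instance instPartialOrder {R : Type*} [Semigroup R] [StarMul R] : PartialOrder (Proj R) where
  le p q := p.val * q.val = p.val
  le_refl p := p.isProj.isIdempotentElem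
  le_trans p q r hpq hqr := by
    change p.val * r.val = p.val
    change p.val * q.val = p.val at hpq
    change q.val * r.val = q.val at hqr
    rw [← hpq, mul_assoc, hqr]
  le_antisymm p q hpq hqp := by
    change p.val * q.val = p.val at hpq
    change q.val * p.val = q.val at hqp
    apply ext_val
    have h := congrArg star hpq
    rw [star_mul, p.isProj.isSelfAdjoint.star_eq, q.isProj.isSelfAdjoint.star_eq, hqp] at h
    exact h.symm

theorem le_iff {R : Type*} [Semigroup R] [StarMul R] {p q : Proj R} :
    p ≤ q ↔ p.val * q.val = p.val := Iff.rfl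

/-- The image `π(p)` of a projection `p` under a (unital) `*`-homomorphism `π`. -/
def map {𝕜 R S : Type*} [CommSemiring 𝕜] [Semiring R] [Algebra 𝕜 R] [StarRing R]
    [Semiring S] [Algebra 𝕜 S] [StarRing S] (π : R →⋆ₐ[𝕜] S) (p : Proj R) : Proj S where
  val := π p.val
  isProj := ⟨by
      change π p.val * π p.val = π p.val
      rw [← map_mul, p.isProj.isIdempotentElem.eq], by
      change star (π p.val) = π p.val
      rw [← map_star, p.isProj.isSelfAdjoint.star_eq]⟩

end Proj

/-- Real rank zero for a unital algebra: the invertible self-adjoint elements are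
dense in the self-adjoint elements. -/
def HasRealRankZero (R : Type*) [NormedRing R] [StarRing R] : Prop :=
  {a : R | IsSelfAdjoint a} ⊆ closure {a : R | IsSelfAdjoint a ∧ IsUnit a}

/-- The `ω`-property for a unital algebra: `‖p^⊥ pₙ‖ → 0` whenever `(pₙ)` is a decreasing sequence
of projections that is below the projection `p`, i.e. such that every projection `r` of the algebra
with `r ≤ pₙ` for all `n` satisfies `r ≤ p`. -/
def HasOmegaProperty (R : Type*) [NormedRing R] [StarRing R] : Prop :=
  ∀ (p : Proj R) (P : ℕ → Proj R), Antitone P → (∀ r : Proj R, (∀ n, r ≤ P n) → r ≤ p) →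
    Tendsto (fun n => ‖(1 - p.val) * (P n).val‖) atTop (𝓝 0)

section Hilbert

variable {𝕜 : Type*} [RCLike 𝕜] {H : Type*} [NormedAddCommGroup H] [InnerProductSpace 𝕜 H]
  [CompleteSpace H]

/-- The range `ℛ(T)` of a bounded operator `T`, as a linear subspace. -/
def opRange (T : H →L[𝕜] H) : Submodule 𝕜 H := LinearMap.range (T : H →ₗ[𝕜] H)

/-- The least upper bound `⋁ pₙ` of a sequence of projections in `𝒫(ℬ(H))`: the orthogonal
projection onto the closed linear span of the ranges (see `isLUB_projSup`). -/
noncomputable def projSup (p : ℕ → Proj (H →L[𝕜] H)) : Proj (H →L[𝕜] H) where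
  val := (⨆ n, opRange (p n).val).topologicalClosure.starProjection
  isProj := isStarProjection_starProjection

theorem mem_opRange_iff (p : Proj (H →L[𝕜] H)) (x : H) :
    x ∈ opRange p.val ↔ p.val x = x := by
  constructor
  · rintro ⟨y, rfl⟩
    exact DFunLike.congr_fun p.isProj.isIdempotentElem.eq y
  · intro h
    exact ⟨x, h⟩

theorem Proj.le_iff_opRange_le (p q : Proj (H →L[𝕜] H)) :
    p ≤ q ↔ opRange p.val ≤ opRange q.val := by
  have hs : p ≤ q ↔ q.val * p.val = p.val := by
    rw [Proj.le_iff, ← star_inj, star_mul, p.isProj.isSelfAdjoint.star_eq,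
      q.isProj.isSelfAdjoint.star_eq]
  rw [hs]
  constructor
  · rintro h _ ⟨y, rfl⟩
    rw [mem_opRange_iff]
    exact DFunLike.congr_fun h y
  · intro h
    ext y
    exact (mem_opRange_iff q _).1 (h ⟨y, rfl⟩)

theorem isClosed_opRange (p : Proj (H →L[𝕜] H)) : IsClosed (opRange p.val : Set H) := by
  have h : (opRange p.val : Set H) = {x | p.val x = x} := by
    ext x
    exact mem_opRange_iff p x
  rw [h]
  exact isClosed_eq p.val.continuous continuous_id

theorem opRange_projSup (p : ℕ → Proj (H →L[𝕜] H)) :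
    opRange (projSup p).val = (⨆ n, opRange (p n).val).topologicalClosure := by
  ext x
  rw [mem_opRange_iff]
  exact Submodule.starProjection_eq_self_iff

theorem isLUB_projSup (p : ℕ → Proj (H →L[𝕜] H)) : IsLUB (range p) (projSup p) := by
  constructor
  · rintro _ ⟨n, rfl⟩
    rw [Proj.le_iff_opRange_le, opRange_projSup]
    exact (le_iSup (fun n => opRange (p n).val) n).trans (Submodule.le_topologicalClosure _)
  · intro q hq
    rw [Proj.le_iff_opRange_le, opRange_projSup]
    refine Submodule.topologicalClosure_minimal _ (iSup_le fun n => ?_) (isClosed_opRange q)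
    exact (Proj.le_iff_opRange_le _ _).1 (hq ⟨n, rfl⟩)

end Hilbert

/-! Real rank zero supplies spectral projections up to a small error. For `X` in `A`, an invertible
self-adjoint `B` near `X*X - δ` splits `H` into a part where `X` is bounded below and a part where
`X` is small; the range of `X` on the first part is the range of a projection of the form `X * a`
(`exists_proj_mul_approx`). Applied to `X = (1 - Q) P`, this enlarges `Q` by a projection in `(1 -
Q) P A`, so that the result almost dominates `P`. Iterating gives increasing `Q n = ∑ k ≤ n, P k * b
k` with `‖(1 - Q n) P k‖` arbitrarily small for each `k` (`exists_monotone_proj`). Both properties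
are algebraic or norm estimates, so they survive the contractive map `π`: the sums give exact range
inclusions without closures, the estimates give equality of suprema. For the second claim, `π (Q n)`
and `π (P n)` have the same least upper bound in `π[A]`, and the `ω`-property forces an increasing
sequence to reach its least upper bound at a finite stage. -/

/-! ### Square roots and coercive operators. -/

/-- In a complete normed `*`-algebra, `1 - y` has a self-adjoint square root near `1` when `y` is
self-adjoint with `‖y‖ < 1`, and this root commutes with everything that commutes with `y`. -/
theorem exists_sqrt_one_sub (𝕜 : Type*) [RCLike 𝕜] {R : Type*} [NormedRing R] [NormedAlgebra 𝕜 R]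
    [StarRing R] [NormedStarGroup R] [StarModule 𝕜 R] [CompleteSpace R] (y : R)
    (hy : IsSelfAdjoint y) (h : ‖y‖ < 1) :
    ∃ s : R, IsSelfAdjoint s ∧ s * s = 1 - y ∧ ‖1 - s‖ < 1 ∧ ∀ b, Commute b y → Commute b s := by
  -- A fixed point of `z ↦ (y + z²) / 2` satisfies `(1 - z)² = 1 - y`. Self-adjointness and
  -- commutation are closed conditions, so they are built into the invariant set.
  set K : Set R := {z | ‖z‖ ≤ ‖y‖ ∧ star z = z ∧ ∀ b, Commute b y → b * z = z * b} with hK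
  have hKc : IsClosed K := by
    have hcomm : IsClosed (⋂ b, ⋂ _ : Commute b y, {z : R | b * z = z * b}) :=
      isClosed_iInter fun b => isClosed_iInter fun _ =>
        isClosed_eq (continuous_const.mul continuous_id) (continuous_id.mul continuous_const)
    convert (isClosed_le continuous_norm (continuous_const (y := ‖y‖))).inter
      ((isClosed_eq continuous_star continuous_id).inter hcomm) using 1
    ext z
    simp [hK]
  have h2 : ‖(2 : 𝕜)⁻¹‖ = 2⁻¹ := by simp
  set f : R → R := fun z => (2 : 𝕜)⁻¹ • (y + z * z) with hf
  have hmaps : MapsTo f K K := by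
    rintro z ⟨hz1, hz2, hz3⟩
    refine ⟨?_, ?_, fun b hb => ?_⟩
    · rw [hf, norm_smul, h2]
      have h3 : ‖y + z * z‖ ≤ ‖y‖ + ‖z‖ * ‖z‖ :=
        (norm_add_le _ _).trans (by gcongr; exact norm_mul_le _ _)
      nlinarith [norm_nonneg z, norm_nonneg y]
    · simp [hf, star_smul, hy.star_eq, hz2]
    · have h4 : Commute b z := hz3 b hb
      exact ((hb.add_right (h4.mul_right h4)).smul_right _).eq
  have hcontr : ContractingWith ⟨‖y‖, norm_nonneg y⟩ (hmaps.restrict f K K) := by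
    refine ⟨by exact_mod_cast h, LipschitzWith.of_dist_le_mul ?_⟩
    rintro ⟨z, hz⟩ ⟨w, hw⟩
    change dist (f z) (f w) ≤ ‖y‖ * dist z w
    rw [dist_eq_norm, dist_eq_norm, hf, ← smul_sub, norm_smul, h2]
    have h5 : y + z * z - (y + w * w) = z * (z - w) + (z - w) * w := by noncomm_ring
    have h6 : ‖z * (z - w) + (z - w) * w‖ ≤ ‖z‖ * ‖z - w‖ + ‖z - w‖ * ‖w‖ :=
      (norm_add_le _ _).trans (add_le_add (norm_mul_le _ _) (norm_mul_le _ _))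
    rw [h5]
    nlinarith [norm_nonneg (z - w), hz.1, hw.1]
  obtain ⟨z, hzK, hzf, -⟩ := hcontr.exists_fixedPoint' hKc.isComplete hmaps
    (x := 0) ⟨by simp, by simp, by simp⟩ (edist_ne_top _ _)
  have hz : z + z = y + z * z := by
    have h7 : (2 : 𝕜) • f z = (2 : 𝕜) • z := congrArg _ hzf
    rw [hf, smul_inv_smul₀ two_ne_zero, two_smul] at h7
    exact h7.symm
  refine ⟨1 - z, ?_, ?_, ?_, fun b hb => (Commute.one_right b).sub_right (hzK.2.2 b hb)⟩
  · exact (IsSelfAdjoint.one R).sub hzK.2.1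
  · have : (1 - z) * (1 - z) = 1 - (z + z) + z * z := by noncomm_ring
    rw [this, hz]; abel
  · simpa using hzK.1.trans_lt h

open RCLike in
/-- A coercive operator is, up to scaling, within distance less than `1` of the identity. -/
theorem exists_norm_one_sub_smul_lt_one {𝕜 : Type*} [RCLike 𝕜] {H : Type*}
    [NormedAddCommGroup H] [InnerProductSpace 𝕜 H] (G : H →L[𝕜] H) {m : ℝ} (hm : 0 < m)
    (hG : ∀ x, m * ‖x‖ ^ 2 ≤ re (inner 𝕜 (G x) x)) :
    ∃ t : ℝ, 0 < t ∧ ‖1 - (t : 𝕜) • G‖ < 1 := by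
  set M : ℝ := ‖G‖ + m
  have hM : 0 < M := by positivity
  have hmM : m ≤ M := le_add_of_nonneg_left (norm_nonneg _)
  -- This minimizes the bound `1 - 2tm + t²M²` for `‖x - t G x‖² / ‖x‖²`; the minimum is `1 - tm`.
  set t : ℝ := m / M ^ 2
  have ht : 0 < t := by positivity
  have hlt : √(1 - t * m) < 1 := by
    rw [Real.sqrt_lt' one_pos]; nlinarith [mul_pos ht hm]
  have hnn : 0 ≤ 1 - t * m := by
    have : t * m = (m / M) ^ 2 := by simp only [t]; field_simp
    rw [this, sub_nonneg]
    exact pow_le_one₀ (by positivity) ((div_le_one hM).2 hmM)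
  refine ⟨t, ht, (ContinuousLinearMap.opNorm_le_bound _ (Real.sqrt_nonneg _) fun x => ?_).trans_lt
    hlt⟩
  refine abs_le_of_sq_le_sq' ?_ (by positivity) |>.2
  rw [mul_pow, Real.sq_sqrt hnn]
  change ‖x - (t : 𝕜) • G x‖ ^ 2 ≤ _
  rw [@norm_sub_sq 𝕜, norm_smul, norm_ofReal, abs_of_pos ht, inner_smul_right, re_ofReal_mul,
    inner_re_symm]
  have h1 : ‖G x‖ ≤ M * ‖x‖ := (G.le_opNorm x).trans (by gcongr; simp [M, hm.le])
  have h2 : (t * ‖G x‖) ^ 2 ≤ t * m * ‖x‖ ^ 2 := by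
    have h3 : t * m = t ^ 2 * M ^ 2 := by simp only [t]; field_simp
    rw [h3, ← mul_pow, ← mul_pow, mul_assoc]
    gcongr
  have := mul_le_mul_of_nonneg_left (hG x) ht.le
  nlinarith

/-! ### Contractivity of `π` and invertibility inside `A`. -/

section

variable {𝕜 : Type*} [RCLike 𝕜] {H : Type*} [NormedAddCommGroup H] [InnerProductSpace 𝕜 H]
  [CompleteSpace H] {A : StarSubalgebra 𝕜 (H →L[𝕜] H)}

theorem completeSpace_of_isClosed (hA : IsClosed (A : Set (H →L[𝕜] H))) : CompleteSpace A :=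
  hA.completeSpace_coe

instance : NormedStarGroup A := ⟨fun a => (norm_star (a : H →L[𝕜] H)).le⟩

-- For `‖b‖ < 1`, a self-adjoint `s` in `A` with `s² = 1 - b*b` gives `‖π b x‖² = ‖x‖² - ‖π s x‖²`.
open RCLike in
theorem StarSubalgebra.norm_map_le [CompleteSpace A] {H' : Type*} [NormedAddCommGroup H']
    [InnerProductSpace 𝕜 H'] [CompleteSpace H'] (π : A →⋆ₐ[𝕜] (H' →L[𝕜] H')) (a : A) :
    ‖π a‖ ≤ ‖a‖ := by
  refine le_of_forall_pos_le_add fun ε hε => ?_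
  set c : ℝ := ‖a‖ + ε
  have hc : 0 < c := by positivity
  set b : A := ((c : 𝕜)⁻¹) • a
  have hb : ‖b‖ < 1 := by
    rw [norm_smul, norm_inv, norm_ofReal, abs_of_pos hc, inv_mul_lt_one₀ hc]
    exact lt_add_of_pos_right _ hε
  have hb' : ‖star b * b‖ < 1 := by
    have h1 : ‖star b * b‖ ≤ ‖b‖ * ‖b‖ :=
      (norm_mul_le _ _).trans_eq (congrArg (· * ‖b‖) (norm_star b))
    nlinarith [norm_nonneg b]
  obtain ⟨s, hs, hss, -, -⟩ := exists_sqrt_one_sub 𝕜 (star b * b) (.star_mul_self b) hb'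
  have key : ∀ x, ‖π b x‖ ≤ ‖x‖ := by
    intro x
    have h1 : π s * π s = 1 - star (π b) * π b := by
      rw [← map_mul, hss, map_sub, map_one, map_mul, map_star]
    have h2 : ‖π s x‖ ^ 2 = ‖x‖ ^ 2 - ‖π b x‖ ^ 2 := by
      have h3 : star (π s) = π s := by rw [← map_star, hs.star_eq]
      have h4 : (π s * π s) x = x - (star (π b) * π b) x := by rw [h1]; rfl
      have h5 := congrArg (fun v => re (inner 𝕜 v x)) h4
      nth_rw 1 [← h3] at h5
      simp only [mul_apply_eq_comp, inner_sub_left, map_sub,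
        ContinuousLinearMap.star_eq_adjoint, ContinuousLinearMap.adjoint_inner_left,
        inner_self_eq_norm_sq] at h5
      exact h5
    nlinarith [norm_nonneg (π b x), norm_nonneg x, sq_nonneg ‖π s x‖]
  refine ContinuousLinearMap.opNorm_le_bound _ hc.le fun x => ?_
  have : a = (c : 𝕜) • b := by rw [smul_inv_smul₀ (by exact_mod_cast hc.ne')]
  rw [this, map_smul, smul_apply, norm_smul, norm_ofReal, abs_of_pos hc]
  exact mul_le_mul_of_nonneg_left (key x) hc.le

theorem StarSubalgebra.isUnit_of_coercive [CompleteSpace A] (G : A) {m : ℝ} (hm : 0 < m)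
    (hG : ∀ x, m * ‖x‖ ^ 2 ≤ RCLike.re (inner 𝕜 ((G : H →L[𝕜] H) x) x)) : IsUnit G := by
  obtain ⟨t, ht, h⟩ := exists_norm_one_sub_smul_lt_one _ hm hG
  have h1 : IsUnit ((t : 𝕜) • G) := by
    have h2 : ‖1 - (t : 𝕜) • G‖ < 1 := h
    simpa using isUnit_one_sub_of_norm_lt_one h2
  have ht' : (t : 𝕜) ≠ 0 := by exact_mod_cast ht.ne'
  exact (isUnit_smul_iff (Units.mk0 (t : 𝕜) ht') G).1 h1

end

open RCLike in
theorem re_inner_nonneg_of_norm_one_sub_le {𝕜 : Type*} [RCLike 𝕜] {H : Type*}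
    [NormedAddCommGroup H] [InnerProductSpace 𝕜 H] (s : H →L[𝕜] H) (hs : ‖1 - s‖ ≤ 1) (x : H) :
    0 ≤ re (inner 𝕜 (s x) x) := by
  have h1 : re (inner 𝕜 ((1 - s) x) x) ≤ ‖x‖ * ‖x‖ := by
    refine (re_inner_le_norm _ _).trans ?_
    gcongr
    exact ((1 - s).le_opNorm x).trans (mul_le_of_le_one_left (norm_nonneg _) hs)
  have h2 : (1 - s) x = x - s x := rfl
  rw [h2, inner_sub_left, map_sub, inner_self_eq_norm_mul_norm] at h1
  linarith

/-! ### Spectral projections from real rank zero. -/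

section

variable {𝕜 : Type*} [RCLike 𝕜] {H : Type*} [NormedAddCommGroup H] [InnerProductSpace 𝕜 H]
  [CompleteSpace H] {A : StarSubalgebra 𝕜 (H →L[𝕜] H)}

theorem StarSubalgebra.star_apply_inner (a : A) (x y : H) :
    inner 𝕜 (((star a : A) : H →L[𝕜] H) x) y = inner 𝕜 x ((a : H →L[𝕜] H) y) :=
  ContinuousLinearMap.adjoint_inner_left (a : H →L[𝕜] H) y x

open RCLike in
/-- An invertible self-adjoint element `B` has a spectral projection onto its positive part. -/
theorem StarSubalgebra.exists_positive_part_proj [CompleteSpace A] (B : A) (hB : IsSelfAdjoint B)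
    (hu : IsUnit B) : ∃ E : A, IsStarProjection E ∧
      (∀ x, 0 ≤ re (inner 𝕜 (((B * E : A) : H →L[𝕜] H) x) ((E : H →L[𝕜] H) x))) ∧
      ∀ x, re (inner 𝕜 (((B * (1 - E) : A) : H →L[𝕜] H) x)
        (((1 - E : A) : H →L[𝕜] H) x)) ≤ 0 := by
  obtain ⟨C, hCB⟩ : ∃ C : A, C * B = 1 := hu.exists_left_inv
  set c : ℝ := ‖(C : H →L[𝕜] H)‖ + 1
  have hc : 0 < c := by positivity
  have hcoer : ∀ x, (c⁻¹) ^ 2 * ‖x‖ ^ 2 ≤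
      re (inner 𝕜 (((B * B : A) : H →L[𝕜] H) x) x) := by
    intro x
    have h1 : inner 𝕜 (((B * B : A) : H →L[𝕜] H) x) x =
        inner 𝕜 ((B : H →L[𝕜] H) x) ((B : H →L[𝕜] H) x) := by
      have := StarSubalgebra.star_apply_inner B ((B : H →L[𝕜] H) x) x
      rw [hB.star_eq] at this
      exact this
    rw [h1, inner_self_eq_norm_sq, ← mul_pow]
    gcongr
    rw [inv_mul_le_iff₀ hc]
    have h2 : (C : H →L[𝕜] H) ((B : H →L[𝕜] H) x) = x :=
      congrArg (fun T : A => (T : H →L[𝕜] H) x) hCB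
    calc ‖x‖ = ‖(C : H →L[𝕜] H) ((B : H →L[𝕜] H) x)‖ := by rw [h2]
      _ ≤ ‖(C : H →L[𝕜] H)‖ * ‖(B : H →L[𝕜] H) x‖ := ContinuousLinearMap.le_opNorm _ _
      _ ≤ c * ‖(B : H →L[𝕜] H) x‖ := by gcongr; simp [c]
  obtain ⟨t, ht, hlt⟩ := exists_norm_one_sub_smul_lt_one _ (by positivity) hcoer
  set r : 𝕜 := ((√t : ℝ) : 𝕜)
  have hrr : r * r = t := by simp only [r]; rw [← ofReal_mul, Real.mul_self_sqrt ht.le]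
  have hr0 : r ≠ 0 := by simpa [r] using (Real.sqrt_pos.2 ht).ne'
  set D : A := r • B with hD
  have hDsa : star D = D := by simp [hD, r, hB.star_eq]
  have hDD : D * D = (t : 𝕜) • (B * B) := by rw [hD, smul_mul_smul_comm, hrr]
  obtain ⟨s, hs, hss, hs1, hcomm⟩ := exists_sqrt_one_sub 𝕜 (1 - D * D)
    ((IsSelfAdjoint.one A).sub (by rw [IsSelfAdjoint, star_mul, hDsa])) (by rw [hDD]; exact hlt)
  rw [sub_sub_cancel] at hss
  have hDs : Commute D s := hcomm D ((Commute.one_right D).sub_right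
    ((Commute.refl D).mul_right (Commute.refl D)))
  obtain ⟨u, rfl⟩ : IsUnit s := by simpa using isUnit_one_sub_of_norm_lt_one hs1
  -- Here `u` plays the role of `|D|` and `U` of the sign of `D`, a self-adjoint unitary; `E = (1 +
  -- U) / 2` is its eigenprojection for `1`.
  set U : A := D * (u⁻¹ : Aˣ) with hU
  have hDu : Commute D (u⁻¹ : Aˣ) := hDs.units_inv_right
  have hus : star ((u⁻¹ : Aˣ) : A) = (u⁻¹ : Aˣ) := by
    have : star u = u := Units.ext hs
    rw [← Units.coe_star, star_inv, this]
  have hUsa : star U = U := by rw [hU, star_mul, hus, hDsa, hDu.eq]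
  have hUU : U * U = 1 := by
    calc U * U = D * (D * (u⁻¹ : Aˣ)) * (u⁻¹ : Aˣ) := by
          rw [hU, ← mul_assoc, mul_assoc D _ D, ← hDu.eq]
      _ = 1 := by rw [← mul_assoc, ← hss]; simp [mul_assoc]
  have hUu : U * u = D := by simp [hU]
  have huU : u * U = D := by rw [hU, ← mul_assoc, ← hDs.eq]; simp
  set E : A := (2 : 𝕜)⁻¹ • (1 + U) with hE
  have hUE : U * E = E := by rw [hE, mul_smul_comm, mul_add, hUU, mul_one, add_comm]
  have h22 : (2 : 𝕜) • E = 1 + U := by rw [hE, smul_inv_smul₀ two_ne_zero]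
  have hUe : U = E + E - 1 := by rw [← two_smul 𝕜 E, h22]; abel
  have hEE : E * E = E := by
    have : E * E + E * E = E + E := by
      have h := hUE
      rw [hUe, sub_mul, add_mul, one_mul, sub_eq_iff_eq_add] at h
      exact h
    rw [← two_smul 𝕜, ← two_smul 𝕜 E] at this
    exact smul_right_injective A (two_ne_zero (α := 𝕜)) this
  have hDE : D * E = u * E := by rw [← huU, mul_assoc, hUE]
  have hDE' : D * (1 - E) = -(u * (1 - E)) := by
    rw [← huU, mul_assoc, mul_sub, hUE, mul_one, hUe, ← mul_neg]; congr 1; abel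
  have hcommE : Commute E u := by
    rw [hE]
    exact ((Commute.one_left _).add_left (by rw [Commute, SemiconjBy, hUu, huU])).smul_left _
  have hEsa : star E = E := by simp [hE, hUsa]
  have hpos := re_inner_nonneg_of_norm_one_sub_le ((u : A) : H →L[𝕜] H) hs1.le
  have hrpos : 0 < √t := Real.sqrt_pos.2 ht
  have hscale : ∀ (F : A) (x y : H), re (inner 𝕜 (((D * F : A) : H →L[𝕜] H) x) y) =
      √t * re (inner 𝕜 (((B * F : A) : H →L[𝕜] H) x) y) := by
    intro F x y
    rw [hD, smul_mul_assoc]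
    change re (inner 𝕜 (r • ((B * F : A) : H →L[𝕜] H) x) y) = _
    rw [inner_smul_left]
    simp only [r, conj_ofReal, re_ofReal_mul]
  refine ⟨E, ⟨hEE, hEsa⟩, fun x => ?_, fun x => ?_⟩
  · have h := hscale E x ((E : H →L[𝕜] H) x)
    rw [hDE] at h
    exact nonneg_of_mul_nonneg_right ((hpos ((E : H →L[𝕜] H) x)).trans_eq h) hrpos
  · have h := hscale (1 - E) x (((1 - E : A) : H →L[𝕜] H) x)
    rw [hDE'] at h
    have h1 := hpos (((1 - E : A) : H →L[𝕜] H) x)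
    change re (inner 𝕜 (-((u : A) : H →L[𝕜] H) (((1 - E : A) : H →L[𝕜] H) x)) _) = _ at h
    rw [inner_neg_left, map_neg] at h
    exact nonpos_of_mul_nonpos_right (h.symm.trans_le (neg_nonpos.2 h1)) hrpos

open RCLike in
/-- In real rank zero, the range projection of `X` can be approximated by a projection in `X A`. -/
theorem StarSubalgebra.exists_proj_mul_approx [CompleteSpace A] (hrr : HasRealRankZero A) (X : A)
    {η : ℝ} (hη : 0 < η) :
    ∃ a : A, IsStarProjection (X * a) ∧ ‖(1 - X * a) * X‖ ≤ η := by
  -- With `B` within `δ / 2` of `X*X - δ`, `‖X v‖² ≥ (δ/2) ‖v‖²` on the range of `E`, and `‖X w‖² ≤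
  -- (3δ/2) ‖w‖² ≤ η² ‖w‖²` on its complement.
  set δ : ℝ := η ^ 2 / 2
  have hδ : 0 < δ := by positivity
  set T : A := star X * X with hT
  have hTsa : star T = T := by simp [hT]
  have hmem : T - (δ : 𝕜) • 1 ∈ {a : A | IsSelfAdjoint a} := by
    change star _ = _
    simp [hTsa]
  obtain ⟨B, ⟨hBsa, hBu⟩, hBT⟩ := Metric.mem_closure_iff.1 (hrr hmem) (δ / 2) (by positivity)
  obtain ⟨E, ⟨hEE, hEsa⟩, hE1, hE2⟩ := StarSubalgebra.exists_positive_part_proj B hBsa hBu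
  replace hEE : E * E = E := hEE
  replace hEsa : star E = E := hEsa
  have hTform : ∀ v, re (inner 𝕜 ((T : H →L[𝕜] H) v) v) = ‖(X : H →L[𝕜] H) v‖ ^ 2 := by
    intro v
    have : inner 𝕜 ((T : H →L[𝕜] H) v) v =
        inner 𝕜 ((X : H →L[𝕜] H) v) ((X : H →L[𝕜] H) v) :=
      StarSubalgebra.star_apply_inner X ((X : H →L[𝕜] H) v) v
    rw [this, inner_self_eq_norm_sq]
  have hclose : ∀ v, |‖(X : H →L[𝕜] H) v‖ ^ 2 - δ * ‖v‖ ^ 2 - re (inner 𝕜 ((B : H →L[𝕜] H) v) v)| ≤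
      δ / 2 * ‖v‖ ^ 2 := by
    intro v
    have h1 : ‖((T - (δ : 𝕜) • 1 - B : A) : H →L[𝕜] H)‖ ≤ δ / 2 := by
      rw [dist_eq_norm] at hBT; exact hBT.le
    have h2 : ((T - (δ : 𝕜) • 1 - B : A) : H →L[𝕜] H) v =
      (T : H →L[𝕜] H) v - (δ : 𝕜) • v - (B : H →L[𝕜] H) v := rfl
    have h3 : re (inner 𝕜 (((T - (δ : 𝕜) • 1 - B : A) : H →L[𝕜] H) v) v) =
        ‖(X : H →L[𝕜] H) v‖ ^ 2 - δ * ‖v‖ ^ 2 - re (inner 𝕜 ((B : H →L[𝕜] H) v) v) := by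
      rw [h2, inner_sub_left, inner_sub_left, inner_smul_left, map_sub, map_sub, hTform,
        conj_ofReal, re_ofReal_mul, inner_self_eq_norm_sq]
    rw [← h3]
    refine (abs_re_le_norm _).trans ((norm_inner_le_norm _ _).trans ?_)
    rw [sq, ← mul_assoc]
    gcongr
    exact (ContinuousLinearMap.le_opNorm _ _).trans (by gcongr)
  have hsplit : ∀ x, ‖x‖ ^ 2 = ‖(E : H →L[𝕜] H) x‖ ^ 2 + ‖((1 - E : A) : H →L[𝕜] H) x‖ ^ 2 := by
    intro x
    have h1 : x = (E : H →L[𝕜] H) x + ((1 - E : A) : H →L[𝕜] H) x := by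
      change x = (E : H →L[𝕜] H) x + (x - (E : H →L[𝕜] H) x)
      abel
    have h2 : inner 𝕜 ((E : H →L[𝕜] H) x) (((1 - E : A) : H →L[𝕜] H) x) = 0 := by
      have h3 := StarSubalgebra.star_apply_inner E x (((1 - E : A) : H →L[𝕜] H) x)
      rw [hEsa] at h3
      have h4 : E * (1 - E) = 0 := by rw [mul_sub, mul_one, hEE, sub_self]
      have h5 : (E : H →L[𝕜] H) (((1 - E : A) : H →L[𝕜] H) x) = 0 :=
        congrArg (fun F : A => (F : H →L[𝕜] H) x) h4
      rw [h3, h5, inner_zero_right]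
    nth_rw 1 [h1]
    rw [@norm_add_sq 𝕜, h2, map_zero]
    ring
  -- Adding `1 - E` makes the compression of `T` invertible on all of `H`. With `K` its inverse, `X
  -- E K E X*` is the projection onto the range of `X E`.
  set G : A := E * T * E + (1 - E) with hG
  have hGform : ∀ x, min (δ / 2) 1 * ‖x‖ ^ 2 ≤ re (inner 𝕜 ((G : H →L[𝕜] H) x) x) := by
    intro x
    set v := (E : H →L[𝕜] H) x
    set w := ((1 - E : A) : H →L[𝕜] H) x
    have h1 : re (inner 𝕜 ((G : H →L[𝕜] H) x) x) = ‖(X : H →L[𝕜] H) v‖ ^ 2 + ‖w‖ ^ 2 := by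
      have h2 : (G : H →L[𝕜] H) x = (E : H →L[𝕜] H) ((T : H →L[𝕜] H) v) + w := rfl
      have h3 := StarSubalgebra.star_apply_inner E ((T : H →L[𝕜] H) v) x
      have h4 := StarSubalgebra.star_apply_inner (1 - E) w x
      rw [hEsa] at h3
      have h5 : star (1 - E) = 1 - E := by simp [hEsa]
      have h6 : (1 - E) * (1 - E) = 1 - E := by noncomm_ring; rw [hEE]; abel
      have h7 : ((1 - E : A) : H →L[𝕜] H) w = w :=
        congrArg (fun F : A => (F : H →L[𝕜] H) x) h6
      rw [h5, h7] at h4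
      rw [h2, inner_add_left, map_add, h3, h4, hTform, inner_self_eq_norm_sq]
    have h8 := (abs_le.1 (hclose v)).1
    have h9 : 0 ≤ re (inner 𝕜 ((B : H →L[𝕜] H) v) v) := hE1 x
    rw [h1, hsplit x, mul_add]
    have h10 : min (δ / 2) 1 * ‖v‖ ^ 2 ≤ δ / 2 * ‖v‖ ^ 2 := by gcongr; exact min_le_left _ _
    have h11 : min (δ / 2) 1 * ‖w‖ ^ 2 ≤ 1 * ‖w‖ ^ 2 := by gcongr; exact min_le_right _ _
    linarith
  obtain ⟨g, hg⟩ := StarSubalgebra.isUnit_of_coercive G (by positivity) hGform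
  set K : A := ((g⁻¹ : Aˣ) : A)
  have hGE : G * E = E * T * E := by
    rw [hG, add_mul, sub_mul, mul_assoc (E * T), hEE]; simp
  have hEG : E * G = E * T * E := by
    rw [hG, mul_add, mul_sub, ← mul_assoc, ← mul_assoc, hEE]; simp
  have hKG : K * G = 1 := by rw [← hg]; simp [K]
  have hGsa : star G = G := by simp [hG, hEsa, hTsa, mul_assoc]
  have hKsa : star K = K := by
    have : star g = g := Units.ext (by rw [Units.coe_star, hg, hGsa])
    rw [← Units.coe_star, star_inv, this]
  have hKT : K * (E * T * E) = E := by rw [← hGE, ← mul_assoc, hKG, one_mul]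
  have hFX : X * (E * K * E * star X) * X * E = X * E := by
    calc X * (E * K * E * star X) * X * E = X * E * (K * (E * T * E)) := by
          simp only [hT, mul_assoc]
      _ = X * E := by rw [hKT, mul_assoc, hEE]
  have hF : IsStarProjection (X * (E * K * E * star X)) := by
    refine ⟨?_, ?_⟩
    · calc X * (E * K * E * star X) * (X * (E * K * E * star X))
          = (X * (E * K * E * star X) * X * E) * (K * E * star X) := by simp only [mul_assoc]
        _ = X * (E * K * E * star X) := by rw [hFX]; simp only [mul_assoc]
    · change star _ = _
      simp only [star_mul, star_star, hEsa, hKsa, mul_assoc]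
  refine ⟨E * K * E * star X, hF, ?_⟩
  set F : A := X * (E * K * E * star X)
  have hF1 : ‖((1 - F : A) : H →L[𝕜] H)‖ ≤ 1 :=
    IsStarProjection.norm_le _ ⟨congrArg Subtype.val hF.one_sub.isIdempotentElem.eq,
      congrArg Subtype.val hF.one_sub.isSelfAdjoint.star_eq⟩
  have hFXE : (1 - F) * X = (1 - F) * X * (1 - E) := by
    rw [mul_sub ((1 - F) * X), mul_one, sub_mul, sub_mul, one_mul, hFX, sub_self, sub_zero]
  rw [hFXE]
  refine ContinuousLinearMap.opNorm_le_bound _ hη.le fun x => ?_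
  set w := ((1 - E : A) : H →L[𝕜] H) x
  have h1 : ‖(X : H →L[𝕜] H) w‖ ^ 2 ≤ (η * ‖x‖) ^ 2 := by
    have h2 := (abs_le.1 (hclose w)).2
    have h3 : re (inner 𝕜 ((B : H →L[𝕜] H) w) w) ≤ 0 := hE2 x
    have h4 := hsplit x
    have h5 : ‖w‖ ^ 2 ≤ ‖x‖ ^ 2 := by rw [h4]; exact le_add_of_nonneg_left (sq_nonneg _)
    have h6 : η ^ 2 * ‖w‖ ^ 2 ≤ η ^ 2 * ‖x‖ ^ 2 := by gcongr
    have h7 : 0 ≤ η ^ 2 * ‖w‖ ^ 2 := by positivity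
    simp only [δ] at h2
    rw [mul_pow]
    linarith
  calc ‖((1 - F : A) : H →L[𝕜] H) ((X : H →L[𝕜] H) w)‖ ≤ 1 * ‖(X : H →L[𝕜] H) w‖ :=
        (ContinuousLinearMap.le_opNorm _ _).trans (by gcongr)
    _ ≤ η * ‖x‖ := by rw [one_mul]; exact (sq_le_sq₀ (norm_nonneg _) (by positivity)).1 h1

/-! ### The increasing sequence. -/

/-- In real rank zero, `Q` can be enlarged inside the span of the ranges of `Q` and `P` so that it
almost dominates `P`. -/
theorem StarSubalgebra.exists_proj_ge [CompleteSpace A] (hrr : HasRealRankZero A) (Q P : Proj A)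
    {η : ℝ} (hη : 0 < η) :
    ∃ Q' : Proj A, Q ≤ Q' ∧ (∃ a, Q'.val = Q.val + (1 - Q.val) * P.val * a) ∧
      ‖(1 - Q'.val) * P.val‖ ≤ η := by
  obtain ⟨a, hF, hη'⟩ := StarSubalgebra.exists_proj_mul_approx hrr ((1 - Q.val) * P.val) hη
  set F : A := (1 - Q.val) * P.val * a with hFdef
  have hQF : Q.val * F = 0 := by
    rw [hFdef, ← mul_assoc, ← mul_assoc, Q.isProj.mul_one_sub_self, zero_mul, zero_mul]
  have hFQ : F * Q.val = 0 := by
    have := congrArg star hQF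
    rwa [star_mul, hF.isSelfAdjoint.star_eq, Q.isProj.isSelfAdjoint.star_eq, star_zero] at this
  refine ⟨⟨Q.val + F, ?_, Q.isProj.isSelfAdjoint.add hF.isSelfAdjoint⟩, ?_, ⟨a, rfl⟩, ?_⟩
  · change (Q.val + F) * (Q.val + F) = Q.val + F
    rw [mul_add, add_mul, add_mul, Q.isProj.isIdempotentElem.eq, hF.isIdempotentElem.eq, hQF, hFQ,
      add_zero, zero_add]
  · change Q.val * (Q.val + F) = Q.val
    rw [mul_add, hQF, add_zero, Q.isProj.isIdempotentElem.eq]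
  · have : (1 - (Q.val + F)) * P.val = (1 - F) * ((1 - Q.val) * P.val) := by
      rw [← mul_assoc]
      congr 1
      rw [mul_sub, mul_one, sub_mul, one_mul, hFQ]
      abel
    change ‖(1 - (Q.val + F)) * P.val‖ ≤ η
    rwa [this]

theorem StarSubalgebra.exists_monotone_proj [CompleteSpace A] (hrr : HasRealRankZero A)
    (P : ℕ → Proj A) :
    ∃ Q : ℕ → Proj A, Monotone Q ∧
      (∀ n, ∃ b : ℕ → A, (Q n).val = ∑ k ∈ Finset.range (n + 1), (P k).val * b k) ∧
      ∀ k, ∀ ε > 0, ∃ n, ‖(1 - (Q n).val) * (P k).val‖ ≤ ε := by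
  choose f hf1 hf2 hf3 using fun (Q R : Proj A) (n : ℕ) =>
    StarSubalgebra.exists_proj_ge hrr Q R (Nat.one_div_pos_of_nat (α := ℝ) (n := n))
  choose a ha using hf2
  -- Unpairing revisits every `P k` infinitely often, at the stages `Nat.pair k m`, with tolerance
  -- tending to `0`. Since `n.unpair.1 ≤ n`, `S n` involves only `P k` with `k < n`; hence the shift
  -- to `S (n + 1)` below.
  let S : ℕ → Proj A := fun n => Nat.rec ⟨0, .zero A⟩ (fun n q => f q (P n.unpair.1) n) n
  have hS : ∀ n, S (n + 1) = f (S n) (P n.unpair.1) n := fun n => rfl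
  have hsum : ∀ n, ∃ b : ℕ → A, (S n).val = ∑ k ∈ Finset.range n, (P k).val * b k := by
    intro n
    induction n with
    | zero => exact ⟨0, by simp [S]⟩
    | succ n ih =>
      obtain ⟨b, hb⟩ := ih
      set j := n.unpair.1
      have hj : j < n + 1 := Nat.lt_succ_of_le (Nat.unpair_left_le n)
      set c := a (S n) (P j) n
      -- The coefficients come from `S + (1 - S) P_j c = S (1 - P_j c) + P_j c`.
      refine ⟨fun k => (if k < n then b k * (1 - (P j).val * c) else 0) +
        if k = j then c else 0, ?_⟩
      have h1 : ∑ k ∈ Finset.range n, (P k).val *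
          (if k < n then b k * (1 - (P j).val * c) else 0) = (S n).val * (1 - (P j).val * c) := by
        rw [hb, Finset.sum_mul]
        refine Finset.sum_congr rfl fun k hk => ?_
        rw [if_pos (Finset.mem_range.1 hk), mul_assoc]
      simp only [mul_add, Finset.sum_add_distrib]
      rw [Finset.sum_range_succ, h1, if_neg (lt_irrefl n)]
      simp only [mul_ite, mul_zero, Finset.sum_ite_eq', Finset.mem_range, hj, if_true]
      rw [hS, ha]
      noncomm_ring
  refine ⟨fun n => S (n + 1), monotone_nat_of_le_succ fun n => hf1 _ _ _, fun n => hsum (n + 1),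
    fun k ε hε => ?_⟩
  obtain ⟨m, hm⟩ := exists_nat_one_div_lt hε
  refine ⟨Nat.pair k m, ?_⟩
  have h := hf3 (S (Nat.pair k m)) (P k) (Nat.pair k m)
  have h1 : S (Nat.pair k m + 1) = f (S (Nat.pair k m)) (P k) (Nat.pair k m) := by
    rw [hS, Nat.unpair_pair]
  rw [← h1] at h
  refine h.trans (le_trans ?_ hm.le)
  have : (m : ℝ) ≤ Nat.pair k m := by exact_mod_cast Nat.right_le_pair k m
  gcongr

/-! ### Transport along `π` and the `ω`-property. -/

theorem opRange_map_sum_le {H' : Type*} [NormedAddCommGroup H'] [InnerProductSpace 𝕜 H']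
    [CompleteSpace H'] (π : A →⋆ₐ[𝕜] (H' →L[𝕜] H')) (P : ℕ → Proj A) (b : ℕ → A) (s : Finset ℕ) :
    opRange (π (∑ k ∈ s, (P k).val * b k)) ≤ ⨆ k ∈ s, opRange (π (P k).val) := by
  rintro _ ⟨y, rfl⟩
  simp only [map_sum, map_mul, ContinuousLinearMap.coe_coe, sum_apply]
  exact Submodule.sum_mem _ fun k hk =>
    (le_iSup₂ (f := fun k (_ : k ∈ s) => opRange (π (P k).val)) k hk) ⟨π (b k) y, rfl⟩

/-- If `π P x = x`, then `x - π (Q n) x = π ((1 - Q n) P) x`, which contractivity of `π` makes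
small, so `x` is a limit of vectors in the ranges of the `π (Q n)`. -/
theorem Proj.map_le_projSup_map [CompleteSpace A] {H' : Type*} [NormedAddCommGroup H']
    [InnerProductSpace 𝕜 H'] [CompleteSpace H'] (π : A →⋆ₐ[𝕜] (H' →L[𝕜] H')) (P : Proj A)
    (Q : ℕ → Proj A) (h : ∀ ε > 0, ∃ n, ‖(1 - (Q n).val) * P.val‖ ≤ ε) :
    P.map π ≤ projSup fun n => (Q n).map π := by
  rw [Proj.le_iff_opRange_le, opRange_projSup]
  intro x hx
  rw [mem_opRange_iff] at hx
  refine Metric.mem_closure_iff.2 fun ε hε => ?_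
  obtain ⟨n, hn⟩ := h (ε / (‖x‖ + 1)) (by positivity)
  refine ⟨π (Q n).val x, (le_iSup (fun n => opRange ((Q n).map π).val) n) ⟨x, rfl⟩, ?_⟩
  have h1 : π ((1 - (Q n).val) * P.val) x = x - π (Q n).val x := by
    rw [map_mul, map_sub, map_one]
    change π P.val x - π (Q n).val (π P.val x) = _
    rw [show π P.val x = x from hx]
  rw [dist_eq_norm, ← h1]
  calc ‖π ((1 - (Q n).val) * P.val) x‖ ≤ ‖π ((1 - (Q n).val) * P.val)‖ * ‖x‖ :=
        ContinuousLinearMap.le_opNorm _ _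
    _ ≤ ε / (‖x‖ + 1) * ‖x‖ := by gcongr; exact (StarSubalgebra.norm_map_le π _).trans hn
    _ < ε := by
      rw [div_mul_eq_mul_div, div_lt_iff₀ (by positivity)]
      nlinarith

/-- A least upper bound of an increasing sequence of projections is attained under the
`ω`-property. -/
theorem HasOmegaProperty.exists_eq_of_isLUB {B : StarSubalgebra 𝕜 (H →L[𝕜] H)}
    (hω : HasOmegaProperty B) {q : ℕ → Proj B} (hq : Monotone q) {p : Proj B}
    (hp : IsLUB (range q) p) : ∃ n, q n = p := by
  let c : Proj B → Proj B := fun r => ⟨1 - r.val, r.isProj.one_sub⟩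
  have hsymm : ∀ {r s : Proj B}, r ≤ s → s.val * r.val = r.val := fun {r s} hrs => by
    have h := congrArg star (Proj.le_iff.1 hrs)
    rwa [star_mul, r.isProj.isSelfAdjoint.star_eq, s.isProj.isSelfAdjoint.star_eq] at h
  have hc : ∀ {r s : Proj B}, r ≤ c s → s ≤ c r := fun {r s} hrs => by
    have h := hsymm hrs
    change (1 - s.val) * r.val = r.val at h
    change s.val * (1 - r.val) = s.val
    rw [sub_mul, one_mul, sub_eq_self] at h
    rw [mul_sub, mul_one, h, sub_zero]
  have hcc : ∀ r : Proj B, c (c r) = r := fun r => Proj.ext_val (sub_sub_cancel _ _)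
  have hanti : Antitone fun n => c (q n) := fun m n hmn => hc (by rw [hcc]; exact hq hmn)
  -- Complementation turns projections below every `1 - q n` into upper bounds of `q`, so leastness
  -- of `p` is the hypothesis of the `ω`-property.
  have hlim := hω (c p) (fun n => c (q n)) hanti fun r hr =>
    hc (hp.2 (by rintro _ ⟨n, rfl⟩; exact hc (hr n)))
  obtain ⟨n, hn⟩ := (hlim.eventually (gt_mem_nhds one_pos)).exists
  refine ⟨n, Proj.ext_val ?_⟩
  have h1 : q n ≤ p := hp.1 ⟨n, rfl⟩
  have h2 : (1 - (c p).val) * (c (q n)).val = p.val - (q n).val := by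
    change (1 - (1 - p.val)) * (1 - (q n).val) = _
    rw [sub_sub_cancel, mul_sub, mul_one, hsymm h1]
  rw [h2] at hn
  set e : B := p.val - (q n).val with he
  have hee : e * e = e := by
    rw [he, sub_mul, mul_sub, mul_sub, p.isProj.isIdempotentElem.eq, hsymm h1,
      (q n).isProj.isIdempotentElem.eq, Proj.le_iff.1 h1]
    abel
  -- A projection of norm less than `1` vanishes. The inverse is taken in the ambient operator
  -- algebra because `B` is not assumed complete.
  have hu : IsUnit (1 - (e : H →L[𝕜] H)) := isUnit_one_sub_of_norm_lt_one hn
  have h0 : (1 - (e : H →L[𝕜] H)) * (e : H →L[𝕜] H) = 0 := by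
    have : (e : H →L[𝕜] H) * (e : H →L[𝕜] H) = e := congrArg Subtype.val hee
    rw [sub_mul, one_mul, this, sub_self]
  have he0 : e = 0 := Subtype.ext (hu.mul_right_eq_zero.1 h0)
  exact (sub_eq_zero.1 he0).symm

end

theorem mainTheorem8 {𝕜 : Type*} [RCLike 𝕜]
    {H : Type*} [NormedAddCommGroup H] [InnerProductSpace 𝕜 H] [CompleteSpace H]
    {H' : Type*} [NormedAddCommGroup H'] [InnerProductSpace 𝕜 H'] [CompleteSpace H']
    (A : StarSubalgebra 𝕜 (H →L[𝕜] H)) (hA : IsClosed (A : Set (H →L[𝕜] H)))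
    (hrr : HasRealRankZero A)
    (π : A →⋆ₐ[𝕜] (H' →L[𝕜] H')) (hω : HasOmegaProperty π.range)
    (P : ℕ → Proj A) :
    (∃ Q : ℕ → Proj A, Monotone Q ∧
      (∀ n, opRange ((Q n).val : H →L[𝕜] H) ≤
        ⨆ k ∈ Finset.range (n + 1), opRange ((P k).val : H →L[𝕜] H)) ∧
      projSup (fun n => (P n).map π) = projSup (fun n => (Q n).map π)) ∧
    (∀ p : Proj π.range, IsLUB (range fun n => (P n).map π.rangeRestrict) p →
      ∃ R : Proj A, R.map π.rangeRestrict = p ∧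
        opRange (R.val : H →L[𝕜] H) ≤ ⨆ n, opRange ((P n).val : H →L[𝕜] H)) := by
  have : CompleteSpace A := completeSpace_of_isClosed hA
  obtain ⟨Q, hmono, hsum, happrox⟩ := StarSubalgebra.exists_monotone_proj hrr P
  have hrange : ∀ n, opRange ((Q n).val : H →L[𝕜] H) ≤
      ⨆ k ∈ Finset.range (n + 1), opRange ((P k).val : H →L[𝕜] H) := by
    intro n
    obtain ⟨b, hb⟩ := hsum n
    rw [hb]
    -- The inclusion of `A` serves as the representation here; `π` itself is used for `hQP`.
    exact opRange_map_sum_le A.subtype P b _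
  have hPQ : ∀ k, (P k).map π ≤ projSup fun n => (Q n).map π := fun k =>
    Proj.map_le_projSup_map π (P k) Q (happrox k)
  have hQP : ∀ n, opRange (π (Q n).val) ≤
      ⨆ k ∈ Finset.range (n + 1), opRange (π (P k).val) := by
    intro n
    obtain ⟨b, hb⟩ := hsum n
    rw [hb]
    exact opRange_map_sum_le π P b _
  refine ⟨⟨Q, hmono, hrange, le_antisymm ?_ ?_⟩, fun p hp => ?_⟩
  · exact (isLUB_projSup _).2 (by rintro _ ⟨k, rfl⟩; exact hPQ k)
  · refine (isLUB_projSup _).2 ?_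
    rintro _ ⟨n, rfl⟩
    rw [Proj.le_iff_opRange_le, opRange_projSup]
    exact (hQP n).trans ((iSup₂_le fun k _ => le_iSup (fun k => opRange (π (P k).val)) k).trans
      (Submodule.le_topologicalClosure _))
  · have hle : ∀ r s : Proj π.range, r ≤ s ↔
        r.map π.range.subtype ≤ s.map π.range.subtype := fun r s =>
      ⟨fun h => congrArg Subtype.val h, fun h => Subtype.ext h⟩
    have hmonoπ : Monotone fun n => (Q n).map π.rangeRestrict := fun m n hmn => by
      change π.rangeRestrict _ * π.rangeRestrict _ = π.rangeRestrict _
      rw [← map_mul, Proj.le_iff.1 (hmono hmn)]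
    -- Both sequences have the same upper bounds in `π[A]`, as comparison inside the operators on
    -- `H'` shows.
    have hlub : IsLUB (range fun n => (Q n).map π.rangeRestrict) p := by
      constructor
      · rintro _ ⟨n, rfl⟩
        rw [hle, Proj.le_iff_opRange_le]
        refine (hQP n).trans (iSup₂_le fun k _ => ?_)
        exact (Proj.le_iff_opRange_le _ _).1 ((hle _ _).1 (hp.1 ⟨k, rfl⟩))
      · intro r hr
        refine hp.2 ?_
        rintro _ ⟨k, rfl⟩
        rw [hle]
        refine (hPQ k).trans ((isLUB_projSup _).2 ?_)
        rintro _ ⟨n, rfl⟩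
        exact (hle _ _).1 (hr ⟨n, rfl⟩)
    obtain ⟨n, hn⟩ := HasOmegaProperty.exists_eq_of_isLUB hω hmonoπ hlub
    exact ⟨Q n, hn, (hrange n).trans
      (iSup₂_le fun k _ => le_iSup (fun k => opRange ((P k).val : H →L[𝕜] H)) k)⟩
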